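/- Let $(T,d)$ be a compact metric space with Borel $\sigma$-algebra $\Sigma$, let $\mu:\Sigma\to[0,\infty)$ be a finite measure with $\mu(\{t\})=0$ for every $t\in T$, and let $X$ be a real Banach space. Let $cwk(X)$ be the family of all nonempty convex weakly compact subsets of $X$, with the Minkowski operations and the Hausdorff distance $d_H$. A partition of $E\in\Sigma$ is a finite family $\Pi=\{(E_j,t_j)\}_{j\le k}$ with $E_j\in\Sigma$, $t_j\in T$, $\mu(E_i\cap E_j)=0$ for $i\ne j$ and $\bigcup_jE_j=E$ (the tags need not lie in $E_j$ or in $E$). A gauge is a function $\gamma:T\to(0,\infty)$, and $\Pi$ is $\gamma$-fine if $d(w,t_j)<\gamma(t_j)$ for all $j$ and all $w\in E_j$. For $F:T\to cwk(X)$ put $\sum_\Pi F=\sum_j\mu(E_j)F(t_j)$. The multifunction $F$ is H-integrable if there is $J\in cwk(X)$ such that for every $\varepsilon>0$ there is a gauge $\gamma$ with $d_H(\sum_\Pi F,J)\le\varepsilon$ for every $\gamma$-fine partition $\Pi$ of $T$. For $E\in\Sigma$, let $\Phi(F,E)$ be the set of all $z\in X$ such that for every $\varepsilon>0$ there is a gauge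 $\gamma$ with $\inf\{\|z-c\|:c\in\sum_\Pi F\}\le\varepsilon$ for every $\gamma$-fine partition $\Pi$ of $E$. A Rådström embedding of $cwk(X)$ is a map $i:cwk(X)\to C(\Omega)$, where $\Omega$ is a compact Hausdorff space and $C(\Omega)$ is the space of continuous real functions on $\Omega$ with the supremum norm, such that $i(A+B)=i(A)+i(B)$ and $i(\lambda A)=\lambda i(A)$ for $\lambda\ge0$; $d_H(A,B)=\|i(A)-i(B)\|_\infty$; the range of $i$ is closed; and $i(\overline{\mathrm{co}}(A\cup B))=\max\{i(A),i(B)\}$. Such an embedding of $cwk(X)$ exists. Moreover, let $F:T\to cwk(X)$ be H-integrable. Then $M(E):=\Phi(F,E)$ belongs to $cwk(X)$ for every $E\in\Sigma$, and: 1. $M:\Sigma\to cwk(X)$ is a countably additive multimeasure. That is, $M(\emptyset)=\{0\}$ and, for every pairwise disjoint sequence $(E_n)$ in $\Sigma$, the series $\sum_n x_n$ converges unconditionally in $X$ for every choice of $x_n\in M(E_n)$, and $M(\bigcup_nE_n)=\sum_nM(E_n):=\{\sum_nx_n:\ x_n\in M(E_n)\text{ for all }n\}$. 2. For every Rådström embedding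 $i$ of $cwk(X)$, the set function $i\circ M:\Sigma\to C(\Omega)$ is $\sigma$-additive in norm ($i(M(\bigcup_nE_n))=\sum_ni(M(E_n))$, with unconditional convergence, for every pairwise disjoint sequence $(E_n)$ in $\Sigma$) and $\mu$-absolutely continuous (for every $\varepsilon>0$ there is $\delta>0$ such that $\|i(M(E))\|_\infty<\varepsilon$ whenever $E\in\Sigma$ and $\mu(E)<\delta$). -/

import Mathlib

open Set MeasureTheory
open scoped Pointwise

namespace HMultifun

/-! ### The hyperspace `cwk(X)` -/

section Hyperspace

variable {X : Type*} [NormedAddCommGroup X] [NormedSpace ℝ X]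

/-- `A` is a nonempty, convex, weakly compact subset of `X`. -/
structure IsCwk (A : Set X) : Prop where
  nonempty : A.Nonempty
  convex : Convex ℝ A
  isCompact_weak : IsCompact (toWeakSpace ℝ X '' A)

theorem IsCwk.add {A B : Set X} (hA : IsCwk A) (hB : IsCwk B) : IsCwk (A + B) where
  nonempty := hA.nonempty.add hB.nonempty
  convex := hA.convex.add hB.convex
  isCompact_weak := by
    rw [Set.image_add]
    exact hA.isCompact_weak.add hB.isCompact_weak

theorem IsCwk.smul {A : Set X} (c : ℝ) (hA : IsCwk A) : IsCwk (c • A) where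
  nonempty := hA.nonempty.smul_set
  convex := hA.convex.smul c
  isCompact_weak := by
    rw [Set.image_smul_comm _ c A (fun b => map_smul (toWeakSpace ℝ X) c b)]
    exact hA.isCompact_weak.smul c

theorem IsCwk.singleton (x : X) : IsCwk ({x} : Set X) where
  nonempty := Set.singleton_nonempty x
  convex := convex_singleton x
  isCompact_weak := by simp

theorem IsCwk.closure_convexHull_union {A B : Set X} (hA : IsCwk A) (hB : IsCwk B) :
    IsCwk (closure (convexHull ℝ (A ∪ B))) where
  nonempty := (convexHull_nonempty_iff.2 (hA.nonempty.mono subset_union_left)).closure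
  convex := (convex_convexHull ℝ _).closure
  isCompact_weak := by
    rw [(convex_convexHull ℝ (A ∪ B)).toWeakSpace_closure ℝ]
    refine IsCompact.closure ?_
    have hK : IsCompact (Icc (0 : ℝ) 1 ×ˢ
        ((toWeakSpace ℝ X '' A) ×ˢ (toWeakSpace ℝ X '' B))) :=
      isCompact_Icc.prod (hA.isCompact_weak.prod hB.isCompact_weak)
    have hf : Continuous (fun p : ℝ × (WeakSpace ℝ X × WeakSpace ℝ X) =>
        (1 - p.1) • p.2.1 + p.1 • p.2.2) := by fun_prop
    convert hK.image hf using 1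
    rw [convexHull_union hA.nonempty hB.nonempty, hA.convex.convexHull_eq,
      hB.convex.convexHull_eq]
    ext y
    simp only [Set.mem_image, mem_convexJoin, Set.mem_prod, Prod.exists, segment_eq_image]
    constructor
    · rintro ⟨_, ⟨a, ha, b, hb, t, ht, rfl⟩, rfl⟩
      exact ⟨t, toWeakSpace ℝ X a, toWeakSpace ℝ X b, ⟨ht, ⟨a, ha, rfl⟩, ⟨b, hb, rfl⟩⟩, by simp⟩
    · rintro ⟨t, _, _, ⟨ht, ⟨a, ha, rfl⟩, ⟨b, hb, rfl⟩⟩, rfl⟩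
      exact ⟨_, ⟨a, ha, b, hb, t, ht, rfl⟩, by simp⟩

variable (X) in
/-- `cwk(X)`: the family of all nonempty convex weakly compact subsets of `X`. -/
abbrev Cwk : Type _ := {A : Set X // IsCwk A}

/-- Minkowski addition on `cwk(X)`. -/
instance : Add (Cwk X) := ⟨fun A B => ⟨(A : Set X) + (B : Set X), A.2.add B.2⟩⟩

/-- Multiplication by scalars on `cwk(X)`. -/
instance : SMul ℝ (Cwk X) := ⟨fun c A => ⟨c • (A : Set X), A.2.smul c⟩⟩

/-- The closed convex hull of `A ∪ B`, as an element of `cwk(X)`. -/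
def Cwk.hullUnion (A B : Cwk X) : Cwk X :=
  ⟨closure (convexHull ℝ ((A : Set X) ∪ (B : Set X))), A.2.closure_convexHull_union B.2⟩

/-- `i : cwk(X) → C(Ω)` is a Rådström embedding: it is positively linear, isometric for the
Hausdorff distance, has closed range, and turns closed convex hulls of unions into maxima. -/
structure IsRadstromEmbedding {Ω : Type*} [TopologicalSpace Ω] [CompactSpace Ω]
    (i : Cwk X → C(Ω, ℝ)) : Prop where
  map_add : ∀ A B, i (A + B) = i A + i B
  map_smul : ∀ (c : ℝ) (A), 0 ≤ c → i (c • A) = c • i A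
  isometry : ∀ A B : Cwk X, Metric.hausdorffDist (A : Set X) (B : Set X) = ‖i A - i B‖
  isClosed_range : IsClosed (Set.range i)
  map_hullUnion : ∀ A B, i (A.hullUnion B) = i A ⊔ i B

/-- A series of subsets of `X` is unconditionally convergent if, however one chooses a point in
each of its terms, the resulting series in `X` is unconditionally convergent. -/
def UncondConvergent (B : ℕ → Set X) : Prop :=
  ∀ b : ℕ → X, (∀ n, b n ∈ B n) → Summable b

/-- The sum of a series of subsets of `X`: the set of the sums of all convergent series of points
chosen in its terms. -/
def seriesSum (B : ℕ → Set X) : Set X :=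
  {x | ∃ b : ℕ → X, (∀ n, b n ∈ B n) ∧ HasSum b x}

end Hyperspace

/-! ### Partitions and integrals -/

section Integral

variable {T : Type*} [MetricSpace T] [MeasurableSpace T]
variable {X : Type*} [NormedAddCommGroup X] [NormedSpace ℝ X]

/-- A (free, that is not necessarily Perron) partition of `E`: finitely many pairs `(E_j, t_j)` of
a measurable set and a tag in `T`, where the sets overlap only in `μ`-null sets and have
union `E`. -/
structure TaggedPartition (μ : Measure T) (E : Set T) where
  card : ℕ
  part : Fin card → Set T
  tag : Fin card → T
  measurableSet_part : ∀ j, MeasurableSet (part j)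
  null_inter : ∀ j k, j ≠ k → μ (part j ∩ part k) = 0
  iUnion_part : ⋃ j, part j = E

/-- `Π` is `γ`-fine: `d(w, t_j) < γ(t_j)` for all `w ∈ E_j`. -/
def TaggedPartition.IsFine {μ : Measure T} {E : Set T} (P : TaggedPartition μ E)
    (γ : T → ℝ) : Prop :=
  ∀ j, ∀ w ∈ P.part j, dist w (P.tag j) < γ (P.tag j)

/-- A gauge: a strictly positive function on `T`. -/
def IsGauge (γ : T → ℝ) : Prop := ∀ t, 0 < γ t

/-- The Minkowski sum `∑_Π F = ∑ μ(E_j) F(t_j)`. -/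
noncomputable def TaggedPartition.sum {μ : Measure T} {E : Set T} (P : TaggedPartition μ E)
    (F : T → Set X) : Set X :=
  ∑ j, μ.real (P.part j) • F (P.tag j)

/-- H-integrability on `T` of a `cwk(X)`-valued multifunction. -/
def HIntegrable (μ : Measure T) (F : T → Cwk X) : Prop :=
  ∃ J : Cwk X, ∀ ε : ℝ, 0 < ε → ∃ γ : T → ℝ, IsGauge γ ∧
    ∀ P : TaggedPartition μ (Set.univ : Set T), P.IsFine γ →
      Metric.hausdorffDist (P.sum fun t => (F t : Set X)) (J : Set X) ≤ ε

/-- The norm integral `Φ(F, E)`: the points `z` such that for every `ε > 0` there is a gauge `γ`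
with `inf {‖z - c‖ : c ∈ ∑_Π F} ≤ ε` for every `γ`-fine partition `Π` of `E`. -/
def normIntegral (μ : Measure T) (F : T → Set X) (E : Set T) : Set X :=
  {z | ∀ ε : ℝ, 0 < ε → ∃ γ : T → ℝ, IsGauge γ ∧
    ∀ P : TaggedPartition μ E, P.IsFine γ → Metric.infDist z (P.sum F) ≤ ε}

end Integral

/-! ### Multimeasures -/

section Multimeasure

variable {T : Type*} [MeasurableSpace T]

variable (T) in
/-- The σ-algebra of `T`, as a type. -/
abbrev MSet : Type _ := {E : Set T // MeasurableSet E}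

/-- The union of a sequence of measurable sets. -/
def MSet.iUnion (E : ℕ → MSet T) : MSet T :=
  ⟨⋃ n, (E n : Set T), MeasurableSet.iUnion fun n => (E n).2⟩

/-- A countably additive multimeasure `M : Σ → cwk(X)`. -/
structure IsCountablyAdditiveMultimeasure {X : Type*} [NormedAddCommGroup X] [NormedSpace ℝ X]
    (M : MSet T → Cwk X) : Prop where
  empty : (M ⟨∅, MeasurableSet.empty⟩ : Set X) = {0}
  uncondConvergent : ∀ E : ℕ → MSet T, (Pairwise fun m n => Disjoint (E m : Set T) (E n)) →
    UncondConvergent fun n => (M (E n) : Set X)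
  iUnion : ∀ E : ℕ → MSet T, (Pairwise fun m n => Disjoint (E m : Set T) (E n)) →
    (M (MSet.iUnion E) : Set X) = seriesSum fun n => (M (E n) : Set X)

/-- `ν : Σ → Y` is σ-additive: `ν(⋃ E_n) = ∑ ν(E_n)`, with norm-unconditional convergence, for
every disjoint sequence. -/
def SigmaAdditive {Y : Type*} [NormedAddCommGroup Y] (ν : MSet T → Y) : Prop :=
  ∀ E : ℕ → MSet T, (Pairwise fun m n => Disjoint (E m : Set T) (E n)) →
    HasSum (fun n => ν (E n)) (ν (MSet.iUnion E))

/-- `ν : Σ → Y` is `μ`-absolutely continuous: `ν(E) → 0` in norm as `μ(E) → 0`. -/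
def AbsContinuous {Y : Type*} [NormedAddCommGroup Y] (μ : Measure T) (ν : MSet T → Y) : Prop :=
  ∀ ε : ℝ, 0 < ε → ∃ δ : ℝ, 0 < δ ∧ ∀ E : MSet T, μ.real (E : Set T) < δ → ‖ν E‖ < ε

end Multimeasure

end HMultifun

universe u v w

namespace HMultifun

open Filter Topology Metric

/-! ### Weakly compact convex sets and completeness of the Hausdorff distance on them. -/

section CwkBasic

variable {X : Type*} [NormedAddCommGroup X] [NormedSpace ℝ X]

/-! A Rådström embedding `i` turns Minkowski sums into Riemann sums of `i ∘ F` in `C(Ω)` and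
Hausdorff distance into norm distance, so H-integrability of `F` becomes gauge integrability of a
Banach-valued function.

Two fine partitions of `E` can be completed by the same fine partition of the complement, so their
sums are close. This Cauchy criterion yields an indefinite integral `ν`, approximated uniformly in
`E` (`exists_hasIndefiniteIntegral`). Riemann sums lie in the closed range of `i`, hence `ν E = i (M
E)`; the isometry identifies `M E` with `Φ(F, E)` (`normIntegral_eq`).

Additivity comes from concatenating partitions. Since tags are free, compactness gives one finite
set of tags for all `E`, whence `‖ν E‖ ≤ ε/2 + C μ(E)` and absolute continuity; with finite
additivity this gives σ-additivity. Selections are dominated in norm by the embedded sets, which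
carries σ-additivity back to `cwk(X)`.

An embedding is obtained from support functions on the dual unit ball; its range is closed because
`cwk(X)` is complete for the Hausdorff distance. -/

theorem continuous_strongDual_comp_toWeakSpace_symm (f : StrongDual ℝ X) :
    Continuous fun x : WeakSpace ℝ X => f ((toWeakSpace ℝ X).symm x) :=
  WeakBilin.eval_continuous (topDualPairing ℝ X).flip f

theorem IsCwk.isClosed {A : Set X} (hA : IsCwk A) : IsClosed A := by
  have h := hA.isCompact_weak.isClosed.preimage (toWeakSpaceCLM ℝ X).continuous
  convert h using 1
  ext x
  simp

/-- A weakly compact set is norm bounded, by the uniform boundedness principle. -/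
theorem IsCwk.isBounded {A : Set X} (hA : IsCwk A) : Bornology.IsBounded A := by
  obtain ⟨C, hC⟩ := banach_steinhaus
    (g := fun a : A => NormedSpace.inclusionInDoubleDual ℝ X (a : X)) (fun f => by
      obtain ⟨C, hC⟩ := (hA.isCompact_weak.image
        (continuous_strongDual_comp_toWeakSpace_symm f)).isBounded.exists_norm_le
      exact ⟨C, fun a => hC _ ⟨_, ⟨a, a.2, rfl⟩, by simp⟩⟩)
  refine isBounded_iff_forall_norm_le.2 ⟨C, fun a ha => ?_⟩
  have h := hC ⟨a, ha⟩
  exact ((NormedSpace.inclusionInDoubleDualLi ℝ (E := X)).norm_map a).symm.trans_le h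

theorem IsCwk.hausdorffEDist_ne_top {A B : Set X} (hA : IsCwk A) (hB : IsCwk B) :
    hausdorffEDist A B ≠ ⊤ :=
  hausdorffEDist_ne_top_of_nonempty_of_bounded hA.nonempty hB.nonempty hA.isBounded hB.isBounded

/-- A closed convex set that is approximated from outside by weakly compact sets, uniformly in
norm, is weakly compact. -/
theorem IsCwk.of_approx [CompleteSpace X] {A : Set X} (hne : A.Nonempty) (hconv : Convex ℝ A)
    (hcl : IsClosed A)
    (h : ∀ ε > 0, ∃ B : Set X, IsCwk B ∧ ∀ a ∈ A, ∃ b ∈ B, dist a b ≤ ε) : IsCwk A := by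
  -- The ultrafilter is pushed into each approximating set `B n`, where it has a weak limit `x n`.
  -- Testing against functionals makes `x` norm Cauchy, and its limit is the weak limit of `U`.
  refine ⟨hne, hconv, isCompact_iff_ultrafilter_le_nhds'.2 fun U hU => ?_⟩
  obtain ⟨ε, -, hε0, hε⟩ := exists_seq_strictAnti_tendsto (0 : ℝ)
  choose B hB p hpB hp using fun n => h (ε n) (hε0 n)
  let e := toWeakSpace ℝ X
  have hU' : ∀ᶠ u in (U : Filter (WeakSpace ℝ X)), e.symm u ∈ A :=
    mem_of_superset hU (by rintro _ ⟨a, ha, rfl⟩; simpa [e] using ha)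
  have hp' : ∀ n, ∃ q : X → X, ∀ a ∈ A, q a ∈ B n ∧ dist a (q a) ≤ ε n := fun n => by
    classical
    -- The value off `A` is irrelevant, since `U` concentrates on `A`.
    exact ⟨fun a => if ha : a ∈ A then p n a ha else 0, fun a ha => by
      simpa [ha] using ⟨hpB n a ha, hp n a ha⟩⟩
  choose q hq using hp'
  have hlim : ∀ n, ∃ x : X, ∀ f : StrongDual ℝ X,
      Tendsto (fun u => f (q n (e.symm u))) U (𝓝 (f x)) := fun n => by
    obtain ⟨x, -, hx⟩ := isCompact_iff_ultrafilter_le_nhds'.1 (hB n).isCompact_weak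
      (U.map fun u => e (q n (e.symm u)))
      (hU'.mono fun u hu => ⟨_, (hq n _ hu).1, rfl⟩)
    refine ⟨e.symm x, fun f => ?_⟩
    have h1 : Tendsto (fun u => e (q n (e.symm u))) U (𝓝 x) := hx
    exact ((continuous_strongDual_comp_toWeakSpace_symm f).tendsto x).comp h1
  choose x hx using hlim
  have hf : ∀ (f : StrongDual ℝ X) n, ∀ᶠ u in (U : Filter (WeakSpace ℝ X)),
      |f (e.symm u) - f (q n (e.symm u))| ≤ ‖f‖ * ε n := fun f n => by
    filter_upwards [hU'] with u hu
    rw [← map_sub, ← Real.norm_eq_abs]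
    refine (f.le_opNorm _).trans ?_
    rw [← dist_eq_norm]
    gcongr
    exact (hq n _ hu).2
  have hxx : ∀ m n, ‖x m - x n‖ ≤ ε m + ε n := fun m n => by
    refine NormedSpace.norm_le_dual_bound ℝ _ (add_pos (hε0 m) (hε0 n)).le fun f => ?_
    rw [map_sub]
    refine le_of_tendsto ((hx m f).sub (hx n f)).norm ?_
    filter_upwards [hf f m, hf f n] with u h1 h2
    rw [Real.norm_eq_abs]
    rw [abs_le] at *
    constructor <;> linarith
  have hcau : CauchySeq x := by
    refine Metric.cauchySeq_iff'.2 fun δ hδ => ?_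
    obtain ⟨N, hN⟩ := ((hε.eventually (gt_mem_nhds (half_pos hδ))).exists_forall_of_atTop)
    refine ⟨N, fun n hn => ?_⟩
    rw [dist_eq_norm]
    linarith [hxx n N, hN n hn, hN N le_rfl]
  obtain ⟨y, hy⟩ := cauchySeq_tendsto_of_complete hcau
  have hlim : Tendsto (fun u => u) (U : Filter (WeakSpace ℝ X)) (𝓝 (e y)) := by
    refine (WeakBilin.tendsto_iff_forall_eval_tendsto (topDualPairing ℝ X).flip
      (fun a b hab => ?_)).2 fun f => ?_
    · refine (SeparatingDual.eq_iff_forall_dual_eq (R := ℝ)).2 fun g => ?_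
      exact congrArg (fun k => k g) hab
    change Tendsto (fun u => f (e.symm u)) U (𝓝 (f y))
    refine Metric.tendsto_nhds.2 fun δ hδ => ?_
    have hε' : Tendsto (fun n => ‖f‖ * ε n) atTop (𝓝 0) := by simpa using hε.const_mul ‖f‖
    obtain ⟨n, hn1, hn2⟩ := ((hε'.eventually (gt_mem_nhds (by positivity : 0 < δ / 3))).and
      (((f.continuous.tendsto y).comp hy).eventually
        (Metric.ball_mem_nhds _ (by positivity : 0 < δ / 3)))).exists
    filter_upwards [hf f n, (hx n f).eventually
      (Metric.ball_mem_nhds _ (by positivity : 0 < δ / 3))] with u h1 h2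
    simp only [Function.comp_apply, Real.dist_eq] at hn2 h2 ⊢
    rw [abs_lt] at *
    rw [abs_le] at h1
    constructor <;> linarith
  refine ⟨e y, ?_, hlim⟩
  -- Mazur: norm closed convex sets are weakly closed.
  have hclW : IsClosed (toWeakSpace ℝ X '' A) := by
    rw [← closure_eq_iff_isClosed, ← hconv.toWeakSpace_closure ℝ, hcl.closure_eq]
  exact hclW.mem_of_tendsto hlim hU

/-- The Hausdorff limit of a Cauchy sequence in `cwk(X)`. -/
theorem Cwk.exists_tendsto_of_cauchy [CompleteSpace X] (A : ℕ → Cwk X)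
    (hA : ∀ ε > 0, ∃ N, ∀ m ≥ N, ∀ n ≥ N, hausdorffDist (A m : Set X) (A n) < ε) :
    ∃ B : Cwk X, Tendsto (fun n => hausdorffDist (A n : Set X) B) atTop (𝓝 0) := by
  -- The limit exists in the complete space of closed sets; it remains to see that it is nonempty,
  -- convex and weakly compact.
  let C : ℕ → TopologicalSpace.Closeds X := fun n => ⟨A n, (A n).2.isClosed⟩
  have hC : CauchySeq C := by
    refine EMetric.cauchySeq_iff.2 fun ε hε => ?_
    obtain ⟨δ, hδ, hδε⟩ := ENNReal.lt_iff_exists_nnreal_btwn.1 hε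
    obtain ⟨N, hN⟩ := hA δ (by exact_mod_cast hδ)
    refine ⟨N, fun m hm n hn => lt_of_le_of_lt ?_ hδε⟩
    change hausdorffEDist (A m : Set X) (A n) ≤ δ
    rw [← ENNReal.ofReal_toReal ((A m).2.hausdorffEDist_ne_top (A n).2)]
    exact ENNReal.ofReal_le_of_le_toReal (hN m hm n hn).le
  obtain ⟨K, hK⟩ := cauchySeq_tendsto_of_complete hC
  have hE : Tendsto (fun n => hausdorffEDist (A n : Set X) K) atTop (𝓝 0) := by
    exact tendsto_iff_edist_tendsto_0.1 hK
  have hne : (K : Set X).Nonempty := by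
    obtain ⟨n, hn⟩ := (hE.eventually (gt_mem_nhds ENNReal.zero_lt_top)).exists
    exact nonempty_of_hausdorffEDist_ne_top (A n).2.nonempty hn.ne
  have hKA : ∀ ε > 0, ∃ n, hausdorffEDist (A n : Set X) K < ENNReal.ofReal ε := fun ε hε =>
    (hE.eventually (gt_mem_nhds (ENNReal.ofReal_pos.2 hε))).exists
  have hconv : Convex ℝ (K : Set X) := by
    intro x hx y hy a b ha hb hab
    refine K.isClosed.closure_subset_iff.2 subset_rfl (EMetric.mem_closure_iff.2 fun ε hε => ?_)
    obtain ⟨δ, hδ, hδε⟩ := ENNReal.lt_iff_exists_nnreal_btwn.1 hε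
    have hδ' : (0 : ℝ) < δ := by exact_mod_cast hδ
    -- One half pays for moving `x` and `y` into `A n`, the other for moving their combination back
    -- to `K`.
    obtain ⟨n, hn⟩ := hKA (δ / 2) (by positivity)
    obtain ⟨x', hx', hxx⟩ := exists_edist_lt_of_hausdorffEDist_lt hx
      (hausdorffEDist_comm.trans_lt hn)
    obtain ⟨y', hy', hyy⟩ := exists_edist_lt_of_hausdorffEDist_lt hy
      (hausdorffEDist_comm.trans_lt hn)
    obtain ⟨z, hz, hzz⟩ := exists_edist_lt_of_hausdorffEDist_lt
      ((A n).2.convex hx' hy' ha hb hab) hn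
    refine ⟨z, hz, lt_of_lt_of_le ?_ hδε.le⟩
    rw [edist_dist, ← ENNReal.ofReal_coe_nnreal, ENNReal.ofReal_lt_ofReal_iff hδ']
    rw [edist_lt_ofReal] at hxx hyy hzz
    have h1 : dist (a • x + b • y) (a • x' + b • y') ≤ a * dist x x' + b * dist y y' := by
      refine (dist_add_add_le _ _ _ _).trans ?_
      rw [dist_smul₀, dist_smul₀, Real.norm_of_nonneg ha, Real.norm_of_nonneg hb]
    have h2 := dist_triangle (a • x + b • y) (a • x' + b • y') z
    have h3 : a * dist x x' + b * dist y y' ≤ a * (δ / 2) + b * (δ / 2) := by gcongr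
    have h4 : a * ((δ : ℝ) / 2) + b * (δ / 2) = δ / 2 := by rw [← add_mul, hab, one_mul]
    linarith
  have hcwk : IsCwk (K : Set X) := IsCwk.of_approx hne hconv K.isClosed fun ε hε => by
    obtain ⟨n, hn⟩ := hKA ε hε
    refine ⟨A n, (A n).2, fun a ha => ?_⟩
    obtain ⟨b, hb, hab⟩ := exists_edist_lt_of_hausdorffEDist_lt ha
      (hausdorffEDist_comm.trans_lt hn)
    exact ⟨b, hb, (edist_lt_ofReal.1 hab).le⟩
  exact ⟨⟨K, hcwk⟩, by
    exact (ENNReal.tendsto_toReal ENNReal.zero_ne_top).comp hE⟩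

end CwkBasic

/-! ### Support functions and extension from dense subsets. -/

section Support

variable {X : Type*} [NormedAddCommGroup X] [NormedSpace ℝ X]

/-- The support function of a set. -/
noncomputable def supportFun (A : Set X) (f : StrongDual ℝ X) : ℝ := sSup (f '' A)

theorem IsCwk.le_supportFun {A : Set X} (hA : IsCwk A) (f : StrongDual ℝ X) {a : X}
    (ha : a ∈ A) : f a ≤ supportFun A f :=
  le_csSup (f.lipschitz.isBounded_image hA.isBounded).bddAbove (mem_image_of_mem f ha)

theorem supportFun_le {A : Set X} (hA : A.Nonempty) {f : StrongDual ℝ X} {c : ℝ}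
    (h : ∀ a ∈ A, f a ≤ c) : supportFun A f ≤ c :=
  csSup_le (hA.image f) (by rintro _ ⟨a, ha, rfl⟩; exact h a ha)

theorem supportFun_add {A B : Set X} (hA : IsCwk A) (hB : IsCwk B) (f : StrongDual ℝ X) :
    supportFun (A + B) f = supportFun A f + supportFun B f := by
  refine le_antisymm (supportFun_le (hA.add hB).nonempty ?_) ?_
  · rintro _ ⟨a, ha, b, hb, rfl⟩
    simpa using add_le_add (hA.le_supportFun f ha) (hB.le_supportFun f hb)
  · rw [← le_sub_iff_add_le]
    refine supportFun_le hA.nonempty fun a ha => ?_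
    rw [le_sub_comm]
    refine supportFun_le hB.nonempty fun b hb => ?_
    have := (hA.add hB).le_supportFun f (add_mem_add ha hb)
    rw [map_add] at this
    linarith

theorem supportFun_smul {A : Set X} {c : ℝ} (hc : 0 ≤ c) (f : StrongDual ℝ X) :
    supportFun (c • A) f = c * supportFun A f := by
  rw [supportFun, image_smul_comm f c A (map_smul f c), Real.sSup_smul_of_nonneg hc, smul_eq_mul,
    supportFun]

theorem supportFun_closure_convexHull_union {A B : Set X} (hA : IsCwk A) (hB : IsCwk B)
    (f : StrongDual ℝ X) :
    supportFun (closure (convexHull ℝ (A ∪ B))) f = max (supportFun A f) (supportFun B f) := by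
  have hAB := hA.closure_convexHull_union hB
  have hsub : A ∪ B ⊆ closure (convexHull ℝ (A ∪ B)) :=
    (subset_convexHull ℝ _).trans subset_closure
  refine le_antisymm (supportFun_le hAB.nonempty ?_) (max_le ?_ ?_)
  · refine closure_minimal (t := {x | f x ≤ max (supportFun A f) (supportFun B f)})
      (convexHull_min ?_ ?_) (isClosed_le f.continuous continuous_const)
    · rintro x (hx | hx)
      · exact le_max_of_le_left (hA.le_supportFun f hx)
      · exact le_max_of_le_right (hB.le_supportFun f hx)
    · exact convex_halfSpace_le f.toLinearMap.isLinear _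
  · exact supportFun_le hA.nonempty fun a ha => hAB.le_supportFun f (hsub (Or.inl ha))
  · exact supportFun_le hB.nonempty fun a ha => hAB.le_supportFun f (hsub (Or.inr ha))

theorem IsCwk.supportFun_le_add_hausdorffDist {A B : Set X} (hA : IsCwk A) (hB : IsCwk B)
    {f : StrongDual ℝ X} (hf : ‖f‖ ≤ 1) :
    supportFun A f ≤ supportFun B f + hausdorffDist A B := by
  refine le_of_forall_pos_le_add fun ε hε => supportFun_le hA.nonempty fun a ha => ?_
  obtain ⟨b, hb, hab⟩ := exists_dist_lt_of_hausdorffDist_lt ha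
    (lt_add_of_pos_right (hausdorffDist A B) hε) (hA.hausdorffEDist_ne_top hB)
  have h1 : f (a - b) ≤ dist a b := by
    rw [dist_eq_norm]
    exact (le_abs_self _).trans (f.le_of_opNorm_le hf _ |>.trans_eq (one_mul _))
  rw [map_sub] at h1
  linarith [hB.le_supportFun f hb]

/-- A point whose functionals of norm one do not exceed the support function of a convex set by
more than `C` is within distance `C` of the set. -/
theorem IsCwk.infDist_le_of_supportFun {B : Set X} (hB : IsCwk B) {a : X} {C : ℝ} (hC : 0 ≤ C)
    (h : ∀ f : StrongDual ℝ X, ‖f‖ ≤ 1 → f a ≤ supportFun B f + C) : infDist a B ≤ C := by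
  by_contra! hlt
  set r := infDist a B with hr
  have hr0 : 0 < r := hC.trans_lt hlt
  obtain ⟨g, u, hg1, hg2⟩ := geometric_hahn_banach_open (convex_ball a r) isOpen_ball hB.convex
    (disjoint_ball_infDist (x := a) (s := B))
  obtain ⟨b, hb⟩ := hB.nonempty
  have hg0 : 0 < ‖g‖ := norm_pos_iff.2 fun h0 => by
    have h1 := hg1 a (mem_ball_self hr0)
    have h2 := hg2 b hb
    simp only [h0, zero_apply] at h1 h2
    linarith
  -- Any radius strictly between `C` and `r` serves: a closed ball of this radius lies in the
  -- separated open ball, so `‖g‖ * (C + r) / 2 ≤ u - g a`, whereas the hypothesis gives `u - g a ≤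
  -- ‖g‖ * C`.
  have hs0 : 0 < (C + r) / 2 := by positivity
  have hga : ∀ y : X, ‖y‖ < r → g y ≤ u - g a := fun y hy => by
    have := hg1 (a + y) (by simpa [mem_ball, dist_eq_norm] using hy)
    rw [map_add] at this
    linarith
  have hn : ‖g‖ ≤ (u - g a) / ((C + r) / 2) := by
    refine ContinuousLinearMap.opNorm_bound_of_ball_bound hs0 _ g fun y hy => ?_
    rw [mem_closedBall_zero_iff] at hy
    have hyr : ‖y‖ < r := by linarith
    have := hga (-y) (by rwa [norm_neg])
    rw [map_neg] at this
    exact abs_le.2 ⟨by linarith, hga y hyr⟩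
  rw [le_div_iff₀ hs0] at hn
  -- The sign changes because `g` is large on `B`, while the support function bounds from above.
  have hB' : supportFun B (-(‖g‖⁻¹ • g)) ≤ -(‖g‖⁻¹ * u) := by
    refine supportFun_le hB.nonempty fun b hb => ?_
    change -(‖g‖⁻¹ * g b) ≤ _
    have := hg2 b hb
    gcongr
  have hf := h (-(‖g‖⁻¹ • g)) (by
    rw [norm_neg, norm_smul, norm_inv, norm_norm, inv_mul_cancel₀ hg0.ne'])
  change -(‖g‖⁻¹ * g a) ≤ _ at hf
  have h1 : ‖g‖⁻¹ * (u - g a) ≤ C := by linarith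
  rw [inv_mul_le_iff₀ hg0] at h1
  nlinarith

theorem IsCwk.hausdorffDist_le_of_supportFun {A B : Set X} (hA : IsCwk A) (hB : IsCwk B) {C : ℝ}
    (hC : 0 ≤ C)
    (h : ∀ f : StrongDual ℝ X, ‖f‖ ≤ 1 → |supportFun A f - supportFun B f| ≤ C) :
    hausdorffDist A B ≤ C := by
  refine hausdorffDist_le_of_infDist hC (fun a ha => ?_) (fun b hb => ?_)
  · refine hB.infDist_le_of_supportFun hC fun f hf => ?_
    linarith [hA.le_supportFun f ha, (abs_le.1 (h f hf)).2]
  · refine hA.infDist_le_of_supportFun hC fun f hf => ?_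
    linarith [hB.le_supportFun f hb, (abs_le.1 (h f hf)).1]

/-- A bounded function on a discrete space extends to its Stone–Čech compactification. -/
theorem exists_continuousMap_stoneCech {D : Type*} [TopologicalSpace D] [DiscreteTopology D]
    (g : D → ℝ) (R : ℝ) (hg : ∀ d, |g d| ≤ R) :
    ∃ h : C(StoneCech D, ℝ), ∀ d, h (stoneCechUnit d) = g d := by
  let g' : D → Icc (-R) R := fun d => ⟨g d, abs_le.1 (hg d)⟩
  have hg' : Continuous g' := continuous_of_discreteTopology
  let e : StoneCech D → Icc (-R) R := stoneCechExtend hg'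
  have he : Continuous e := continuous_stoneCechExtend hg'
  refine ⟨⟨fun x => e x, continuous_subtype_val.comp he⟩, fun d => ?_⟩
  exact congrArg Subtype.val (stoneCechExtend_stoneCechUnit hg' d)

theorem continuousMap_ext_of_dense {Ω D : Type*} [TopologicalSpace Ω] {u : D → Ω}
    (hu : DenseRange u) {g h : C(Ω, ℝ)} (hgh : ∀ d, g (u d) = h (u d)) : g = h :=
  DFunLike.coe_injective (hu.equalizer g.continuous h.continuous (funext hgh))

theorem norm_continuousMap_le_of_dense {Ω D : Type*} [TopologicalSpace Ω] [CompactSpace Ω]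
    {u : D → Ω} (hu : DenseRange u) {g : C(Ω, ℝ)} {C : ℝ} (hC : 0 ≤ C)
    (hg : ∀ d, |g (u d)| ≤ C) : ‖g‖ ≤ C :=
  (ContinuousMap.norm_le _ hC).2 fun x =>
    hu.induction_on (p := fun x => ‖g x‖ ≤ C) x
      (isClosed_le g.continuous.norm continuous_const) hg

end Support

/-! ### Existence of a Rådström embedding. -/

section Radstrom

variable {X : Type u} [NormedAddCommGroup X] [NormedSpace ℝ X]

/-- This is completeness of `cwk(X)` transported by the isometry. -/
theorem IsRadstromEmbedding.isClosed_range_of_isometry [CompleteSpace X] {Ω : Type*}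
    [TopologicalSpace Ω] [CompactSpace Ω] {i : Cwk X → C(Ω, ℝ)}
    (hi : ∀ A B : Cwk X, hausdorffDist (A : Set X) (B : Set X) = ‖i A - i B‖) :
    IsClosed (range i) := by
  refine isClosed_of_closure_subset fun h hh => ?_
  obtain ⟨x, hx, hxh⟩ := mem_closure_iff_seq_limit.1 hh
  choose A hA using hx
  obtain ⟨B, hB⟩ := Cwk.exists_tendsto_of_cauchy A fun ε hε => by
    obtain ⟨N, hN⟩ := Metric.cauchySeq_iff.1 hxh.cauchySeq ε hε
    refine ⟨N, fun m hm n hn => ?_⟩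
    rw [hi, hA, hA, ← dist_eq_norm]
    exact hN m hm n hn
  refine ⟨B, tendsto_nhds_unique (tendsto_iff_norm_sub_tendsto_zero.2 ?_) hxh⟩
  simpa only [hi, hA] using hB

/-- The Rådström embedding of `cwk(X)` given by support functions on the unit ball of the dual. -/
theorem exists_isRadstromEmbedding [CompleteSpace X] :
    ∃ (Ω : Type u) (_ : TopologicalSpace Ω) (_ : CompactSpace Ω) (_ : T2Space Ω)
      (i : Cwk X → C(Ω, ℝ)), IsRadstromEmbedding i := by
  let D : Type u := {f : StrongDual ℝ X // ‖f‖ ≤ 1}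
  -- With the discrete topology, boundedness of the support functions suffices to extend them to the
  -- Stone–Čech compactification; all identities are then checked on the dense copy of `D`.
  let _ : TopologicalSpace D := ⊥
  have : DiscreteTopology D := ⟨rfl⟩
  have hext : ∀ A : Cwk X, ∃ h : C(StoneCech D, ℝ), ∀ d : D,
      h (stoneCechUnit d) = supportFun (A : Set X) d.1 := fun A => by
    refine exists_continuousMap_stoneCech _ (hausdorffDist (A : Set X) {0}) fun d => ?_
    have h0 : supportFun ({0} : Set X) d.1 = 0 := by simp [supportFun]
    have h1 := A.2.supportFun_le_add_hausdorffDist (IsCwk.singleton 0) d.2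
    have h2 := (IsCwk.singleton 0).supportFun_le_add_hausdorffDist A.2 d.2
    rw [hausdorffDist_comm] at h2
    exact abs_le.2 ⟨by linarith, by linarith⟩
  choose i hi using hext
  have hu : DenseRange (stoneCechUnit : D → StoneCech D) := denseRange_stoneCechUnit
  have hiso : ∀ A B : Cwk X, hausdorffDist (A : Set X) (B : Set X) = ‖i A - i B‖ := by
    intro A B
    refine le_antisymm ?_ (norm_continuousMap_le_of_dense hu hausdorffDist_nonneg fun d => ?_)
    · refine A.2.hausdorffDist_le_of_supportFun B.2 (norm_nonneg _) fun f hf => ?_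
      have := (i A - i B).norm_coe_le_norm (stoneCechUnit (⟨f, hf⟩ : D))
      rwa [ContinuousMap.sub_apply, hi, hi] at this
    · rw [ContinuousMap.sub_apply, hi, hi]
      have h1 := A.2.supportFun_le_add_hausdorffDist B.2 d.2
      have h2 := B.2.supportFun_le_add_hausdorffDist A.2 d.2
      rw [hausdorffDist_comm] at h2
      exact abs_le.2 ⟨by linarith, by linarith⟩
  refine ⟨StoneCech D, inferInstance, inferInstance, inferInstance, i, ?_, ?_, hiso,
    IsRadstromEmbedding.isClosed_range_of_isometry hiso, ?_⟩
  · refine fun A B => continuousMap_ext_of_dense hu fun d => ?_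
    rw [ContinuousMap.add_apply, hi, hi, hi]
    exact supportFun_add A.2 B.2 _
  · refine fun c A hc => continuousMap_ext_of_dense hu fun d => ?_
    rw [ContinuousMap.smul_apply, hi, hi]
    exact supportFun_smul hc _
  · refine fun A B => continuousMap_ext_of_dense hu fun d => ?_
    rw [ContinuousMap.sup_apply, hi, hi, hi]
    exact supportFun_closure_convexHull_union A.2 B.2 _

end Radstrom

/-! ### Gauge integrals of vector-valued functions over free partitions. -/

section VectorIntegral

variable {T : Type*} [MetricSpace T] [MeasurableSpace T] {μ : Measure T}
variable {Y : Type*} [NormedAddCommGroup Y] [NormedSpace ℝ Y]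

/-- The Riemann sum of a vector valued function over a tagged partition. -/
noncomputable def TaggedPartition.vsum {E : Set T} (P : TaggedPartition μ E) (f : T → Y) : Y :=
  ∑ j, μ.real (P.part j) • f (P.tag j)

omit [MetricSpace T] in
theorem TaggedPartition.norm_vsum_le [IsFiniteMeasure μ] {E : Set T} (P : TaggedPartition μ E)
    {f : T → Y} {C : ℝ} (hC : ∀ j, ‖f (P.tag j)‖ ≤ C) : ‖P.vsum f‖ ≤ C * μ.real E := by
  have hE : μ.real E = ∑ j, μ.real (P.part j) := by
    have := measureReal_biUnion_finset₀ (μ := μ) (s := Finset.univ) (f := P.part)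
      (fun j _ k _ hjk => P.null_inter j k hjk)
      (fun j _ => (P.measurableSet_part j).nullMeasurableSet)
    simpa [P.iUnion_part] using this
  rw [hE, Finset.mul_sum]
  refine norm_sum_le_of_le _ fun j _ => ?_
  rw [norm_smul, Real.norm_of_nonneg measureReal_nonneg, mul_comm]
  gcongr
  exact hC j

theorem exists_taggedPartition_append {E₁ E₂ : Set T} (h : Disjoint E₁ E₂)
    (P : TaggedPartition μ E₁) (Q : TaggedPartition μ E₂) {γ : T → ℝ}
    (hP : P.IsFine γ) (hQ : Q.IsFine γ) :
    ∃ R : TaggedPartition μ (E₁ ∪ E₂), R.IsFine γ ∧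
      ∀ f : T → Y, R.vsum f = P.vsum f + Q.vsum f := by
  have hPQ : ∀ j k, μ (P.part j ∩ Q.part k) = 0 := fun j k => by
    rw [disjoint_iff_inter_eq_empty.1 (h.mono
      ((subset_iUnion P.part j).trans_eq P.iUnion_part)
      ((subset_iUnion Q.part k).trans_eq Q.iUnion_part)), measure_empty]
  refine ⟨⟨P.card + Q.card, Fin.append P.part Q.part, Fin.append P.tag Q.tag, ?_, ?_, ?_⟩, ?_, ?_⟩
  · refine Fin.addCases (fun j => ?_) fun j => ?_
    · simpa using P.measurableSet_part j
    · simpa using Q.measurableSet_part j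
  · refine Fin.addCases (fun j => ?_) fun j => Fin.addCases (fun k hjk => ?_) fun k hjk => ?_
    · refine Fin.addCases (fun k hjk => ?_) fun k hjk => ?_
      · simpa using P.null_inter j k (fun e => hjk (e ▸ rfl))
      · simpa using hPQ j k
    · simpa [inter_comm] using hPQ k j
    · simpa using Q.null_inter j k (fun e => hjk (e ▸ rfl))
  · refine Eq.trans ?_ (congrArg₂ (· ∪ ·) P.iUnion_part Q.iUnion_part)
    ext x
    simp only [mem_iUnion, mem_union]
    constructor
    · rintro ⟨j, hj⟩
      revert hj
      refine Fin.addCases (fun j hj => ?_) (fun j hj => ?_) j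
      · exact Or.inl ⟨j, by simpa using hj⟩
      · exact Or.inr ⟨j, by simpa using hj⟩
    · rintro (⟨j, hj⟩ | ⟨j, hj⟩)
      · exact ⟨Fin.castAdd _ j, by simpa using hj⟩
      · exact ⟨Fin.natAdd _ j, by simpa using hj⟩
  · refine Fin.addCases (fun j => ?_) fun j => ?_
    · simpa using hP j
    · simpa using hQ j
  · intro f
    simp [TaggedPartition.vsum, Fin.sum_univ_add]

/-- Fine partitions of all measurable sets exist, with tags in one finite set. -/
theorem exists_isFine_tag_mem [CompactSpace T] [OpensMeasurableSpace T] {γ : T → ℝ}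
    (hγ : IsGauge γ) :
    ∃ s : Finset T, ∀ E : Set T, MeasurableSet E →
      ∃ P : TaggedPartition μ E, P.IsFine γ ∧ ∀ j, P.tag j ∈ s := by
  -- The balls of a finite subcover are made disjoint and cut with `E`. Their centres need not lie
  -- in `E`, so `s` is independent of `E`.
  obtain ⟨s, hs⟩ := CompactSpace.elim_nhds_subcover (fun t => ball t (γ t))
    fun t => ball_mem_nhds t (hγ t)
  refine ⟨s, fun E hE => ?_⟩
  let t : Fin s.card → T := fun j => s.equivFin.symm j
  let B : Fin s.card → Set T := fun j => ball (t j) (γ (t j))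
  have hsub : ∀ j, disjointed B j ⊆ B j := disjointed_subset B
  refine ⟨⟨s.card, fun j => E ∩ disjointed B j, t, fun j => hE.inter ?_, fun j k hjk => ?_, ?_⟩,
    fun j w hw => hsub j hw.2, fun j => (s.equivFin.symm j).2⟩
  · exact disjointedRec (fun _ _ ht => ht.diff measurableSet_ball) measurableSet_ball
  · have := disjoint_disjointed B hjk
    rw [← inter_inter_distrib_left, disjoint_iff_inter_eq_empty.1 this, inter_empty,
      measure_empty]
  · rw [← inter_iUnion, iUnion_disjointed, inter_eq_left]
    intro x _
    have hx : x ∈ ⋃ t ∈ s, ball t (γ t) := hs ▸ mem_univ x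
    simp only [mem_iUnion] at hx ⊢
    obtain ⟨y, hy, hxy⟩ := hx
    exact ⟨s.equivFin ⟨y, hy⟩, by simpa [B, t] using hxy⟩

theorem exists_isFine [CompactSpace T] [OpensMeasurableSpace T] {γ : T → ℝ}
    (hγ : IsGauge γ) {E : Set T} (hE : MeasurableSet E) :
    ∃ P : TaggedPartition μ E, P.IsFine γ := by
  obtain ⟨s, hs⟩ := exists_isFine_tag_mem (μ := μ) hγ
  obtain ⟨P, hP, -⟩ := hs E hE
  exact ⟨P, hP⟩

omit [MetricSpace T] [MeasurableSpace T] in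
theorem IsGauge.min {γ γ' : T → ℝ} (hγ : IsGauge γ) (hγ' : IsGauge γ') :
    IsGauge fun t => min (γ t) (γ' t) :=
  fun t => lt_min (hγ t) (hγ' t)

theorem TaggedPartition.IsFine.mono {E : Set T} {P : TaggedPartition μ E} {γ γ' : T → ℝ}
    (hP : P.IsFine γ) (h : ∀ t, γ t ≤ γ' t) : P.IsFine γ' :=
  fun j w hw => (hP j w hw).trans_le (h _)

/-- The function `f` has indefinite integral `ν`, with Riemann sums converging uniformly in the
domain of integration. -/
def HasIndefiniteIntegral (μ : Measure T) (f : T → Y) (ν : Set T → Y) : Prop :=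
  ∀ ε > 0, ∃ γ : T → ℝ, IsGauge γ ∧ ∀ E : Set T, MeasurableSet E →
    ∀ P : TaggedPartition μ E, P.IsFine γ → ‖P.vsum f - ν E‖ ≤ ε

/-- The Saks–Henstock lemma: integrability over the whole space passes to all measurable sets,
uniformly. -/
theorem exists_hasIndefiniteIntegral [CompactSpace T] [OpensMeasurableSpace T] [CompleteSpace Y]
    {f : T → Y} {y : Y}
    (hf : ∀ ε > 0, ∃ γ : T → ℝ, IsGauge γ ∧ ∀ P : TaggedPartition μ (univ : Set T),
      P.IsFine γ → ‖P.vsum f - y‖ ≤ ε) :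
    ∃ ν : Set T → Y, HasIndefiniteIntegral μ f ν := by
  have hcmp : ∀ ε > 0, ∃ γ : T → ℝ, IsGauge γ ∧ ∀ E : Set T, MeasurableSet E →
      ∀ P Q : TaggedPartition μ E, P.IsFine γ → Q.IsFine γ → ‖P.vsum f - Q.vsum f‖ ≤ ε := by
    intro ε hε
    obtain ⟨γ, hγ, h⟩ := hf (ε / 2) (half_pos hε)
    refine ⟨γ, hγ, fun E hE P Q hP hQ => ?_⟩
    -- The sum over the common completion `R` cancels in the difference.
    obtain ⟨R, hR⟩ := exists_isFine (μ := μ) hγ hE.compl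
    have hsum : ∀ P : TaggedPartition μ E, P.IsFine γ →
        ‖P.vsum f + R.vsum f - y‖ ≤ ε / 2 := fun P hP => by
      obtain ⟨S, hS, hSf⟩ := exists_taggedPartition_append (Y := Y) disjoint_compl_right P R hP hR
      rw [← hSf]
      -- The type of `S` depends on `E ∪ Eᶜ`, so `S` is generalised before that set is rewritten as
      -- `univ`.
      clear hSf
      revert S
      rw [union_compl_self]
      exact h
    have : P.vsum f - Q.vsum f = (P.vsum f + R.vsum f - y) - (Q.vsum f + R.vsum f - y) := by abel
    rw [this]
    linarith [norm_sub_le (P.vsum f + R.vsum f - y) (Q.vsum f + R.vsum f - y), hsum P hP, hsum Q hQ]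
  obtain ⟨ε, -, hε0, hε⟩ := exists_seq_strictAnti_tendsto (0 : ℝ)
  choose γ hγ hcmp using fun n => hcmp (ε n) (hε0 n)
  -- The gauges `γ n` need not decrease, so the comparison passes through a partition fine for both.
  have hcmp2 : ∀ E : Set T, MeasurableSet E → ∀ m n, ∀ P Q : TaggedPartition μ E,
      P.IsFine (γ m) → Q.IsFine (γ n) → ‖P.vsum f - Q.vsum f‖ ≤ ε m + ε n := by
    intro E hE m n P Q hP hQ
    obtain ⟨R, hR⟩ := exists_isFine (μ := μ) ((hγ m).min (hγ n)) hE
    have h1 := hcmp m E hE P R hP (hR.mono fun t => min_le_left _ _)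
    have h2 := hcmp n E hE R Q (hR.mono fun t => min_le_right _ _) hQ
    exact (norm_sub_le_norm_sub_add_norm_sub _ (R.vsum f) _).trans (add_le_add h1 h2)
  have hlim : ∀ E : Set T, ∃ z : Y, MeasurableSet E → ∀ n, ∀ P : TaggedPartition μ E,
      P.IsFine (γ n) → ‖P.vsum f - z‖ ≤ ε n := by
    intro E
    by_cases hE : MeasurableSet E
    swap
    -- Arbitrary value on nonmeasurable sets.
    · exact ⟨0, fun h => absurd h hE⟩
    choose P hP using fun n => exists_isFine (μ := μ) (hγ n) hE
    have hcau : CauchySeq fun n => (P n).vsum f := by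
      refine Metric.cauchySeq_iff'.2 fun δ hδ => ?_
      obtain ⟨N, hN⟩ := (hε.eventually (gt_mem_nhds (half_pos hδ))).exists_forall_of_atTop
      refine ⟨N, fun n hn => ?_⟩
      rw [dist_eq_norm]
      linarith [hcmp2 E hE n N _ _ (hP n) (hP N), hN n hn, hN N le_rfl]
    obtain ⟨z, hz⟩ := cauchySeq_tendsto_of_complete hcau
    refine ⟨z, fun _ n Q hQ => ?_⟩
    have h1 : Tendsto (fun m => ‖Q.vsum f - (P m).vsum f‖) atTop (𝓝 ‖Q.vsum f - z‖) :=
      (tendsto_const_nhds.sub hz).norm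
    have h2 : Tendsto (fun m => ε n + ε m) atTop (𝓝 (ε n)) := by simpa using hε.const_add (ε n)
    exact le_of_tendsto_of_tendsto' h1 h2 fun m => hcmp2 E hE n m _ _ hQ (hP m)
  choose ν hν using hlim
  refine ⟨ν, fun δ hδ => ?_⟩
  obtain ⟨n, hn⟩ := (hε.eventually (gt_mem_nhds hδ)).exists
  exact ⟨γ n, hγ n, fun E hE P hP => (hν E hE n P hP).trans hn.le⟩

variable [CompactSpace T] [OpensMeasurableSpace T] {f : T → Y} {ν : Set T → Y}

theorem HasIndefiniteIntegral.union (h : HasIndefiniteIntegral μ f ν) {E₁ E₂ : Set T}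
    (hE₁ : MeasurableSet E₁) (hE₂ : MeasurableSet E₂) (hd : Disjoint E₁ E₂) :
    ν (E₁ ∪ E₂) = ν E₁ + ν E₂ := by
  refine eq_of_forall_dist_le fun ε hε => ?_
  obtain ⟨γ, hγ, hν⟩ := h (ε / 3) (by positivity)
  obtain ⟨P, hP⟩ := exists_isFine (μ := μ) hγ hE₁
  obtain ⟨Q, hQ⟩ := exists_isFine (μ := μ) hγ hE₂
  obtain ⟨R, hR, hRf⟩ := exists_taggedPartition_append (Y := Y) hd P Q hP hQ
  have h1 := hν _ hE₁ P hP
  have h2 := hν _ hE₂ Q hQ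
  have h3 := hν _ (hE₁.union hE₂) R hR
  rw [hRf] at h3
  rw [dist_eq_norm]
  have : ν (E₁ ∪ E₂) - (ν E₁ + ν E₂) = (P.vsum f - ν E₁) + (Q.vsum f - ν E₂) -
      (P.vsum f + Q.vsum f - ν (E₁ ∪ E₂)) := by abel
  rw [this]
  linarith [norm_sub_le ((P.vsum f - ν E₁) + (Q.vsum f - ν E₂))
      (P.vsum f + Q.vsum f - ν (E₁ ∪ E₂)), norm_add_le (P.vsum f - ν E₁) (Q.vsum f - ν E₂)]

theorem HasIndefiniteIntegral.absContinuous [IsFiniteMeasure μ]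
    (h : HasIndefiniteIntegral μ f ν) :
    ∀ ε > 0, ∃ δ > 0, ∀ E : Set T, MeasurableSet E → μ.real E < δ → ‖ν E‖ < ε := by
  intro ε hε
  obtain ⟨γ, hγ, hν⟩ := h (ε / 2) (half_pos hε)
  obtain ⟨s, hs⟩ := exists_isFine_tag_mem (μ := μ) hγ
  have hC : ∀ t ∈ s, ‖f t‖ ≤ ∑ t ∈ s, ‖f t‖ := fun t ht =>
    Finset.single_le_sum (fun t _ => norm_nonneg (f t)) ht
  set C := ∑ t ∈ s, ‖f t‖
  have hC0 : 0 ≤ C := Finset.sum_nonneg fun t _ => norm_nonneg _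
  -- `C` bounds `f` on tags that serve every `E`; adding 1 avoids division by zero.
  refine ⟨ε / 2 / (C + 1), by positivity, fun E hE hμ => ?_⟩
  obtain ⟨P, hP, hPs⟩ := hs E hE
  have h1 := P.norm_vsum_le (f := f) fun j => hC _ (hPs j)
  have h2 := hν E hE P hP
  rw [lt_div_iff₀ (by positivity)] at hμ
  have h3 := norm_sub_le (P.vsum f) (P.vsum f - ν E)
  rw [sub_sub_cancel] at h3
  nlinarith [measureReal_nonneg (μ := μ) (s := E)]

/-- Applied with `K = range i`, this brings the integral back to `cwk(X)`. -/
theorem HasIndefiniteIntegral.mem_of_isClosed (h : HasIndefiniteIntegral μ f ν) {K : Set Y}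
    (hK : IsClosed K) {E : Set T} (hE : MeasurableSet E)
    (hf : ∀ P : TaggedPartition μ E, P.vsum f ∈ K) : ν E ∈ K := by
  refine hK.closure_subset (Metric.mem_closure_iff.2 fun ε hε => ?_)
  obtain ⟨γ, hγ, hν⟩ := h (ε / 2) (half_pos hε)
  obtain ⟨P, hP⟩ := exists_isFine (μ := μ) hγ hE
  refine ⟨_, hf P, ?_⟩
  rw [dist_comm, dist_eq_norm]
  linarith [hν E hE P hP]

end VectorIntegral

/-! ### From integrals in `C(Ω)` back to sets. -/

section MultifunctionIntegral

variable {T : Type*} [MetricSpace T] [MeasurableSpace T] {μ : Measure T}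
variable {X : Type*} [NormedAddCommGroup X] [NormedSpace ℝ X]
variable {Ω : Type*} [TopologicalSpace Ω] [CompactSpace Ω] {i : Cwk X → C(Ω, ℝ)}

variable (X) in
/-- The zero element `{0}` of `cwk(X)`. -/
def Cwk.zero : Cwk X := ⟨{0}, IsCwk.singleton 0⟩

theorem IsRadstromEmbedding.map_zero (hi : IsRadstromEmbedding i) : i (Cwk.zero X) = 0 := by
  have h := hi.map_add (Cwk.zero X) (Cwk.zero X)
  have h0 : Cwk.zero X + Cwk.zero X = Cwk.zero X :=
    Subtype.ext (by change ({0} : Set X) + {0} = {0}; simp)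
  rw [h0] at h
  exact left_eq_add.1 h

theorem IsRadstromEmbedding.injective (hi : IsRadstromEmbedding i) : Function.Injective i := by
  intro A B h
  have := hi.isometry A B
  rw [h, sub_self, norm_zero] at this
  exact Subtype.ext ((A.2.isClosed.hausdorffDist_zero_iff_eq B.2.isClosed
    (A.2.hausdorffEDist_ne_top B.2)).1 this)

theorem IsRadstromEmbedding.norm_eq (hi : IsRadstromEmbedding i) (A : Cwk X) :
    ‖i A‖ = hausdorffDist (A : Set X) {0} := by
  have := hi.isometry A (Cwk.zero X)
  rw [hi.map_zero, sub_zero] at this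
  exact this.symm

theorem IsRadstromEmbedding.exists_sum (hi : IsRadstromEmbedding i) {ι : Type*} (s : Finset ι)
    (A : ι → Cwk X) : ∃ S : Cwk X, (S : Set X) = ∑ j ∈ s, (A j : Set X) ∧
      i S = ∑ j ∈ s, i (A j) := by
  classical
  induction s using Finset.induction_on with
  | empty => exact ⟨Cwk.zero X, rfl, by simpa using hi.map_zero⟩
  | insert j s hj ih =>
    obtain ⟨S, hS, hiS⟩ := ih
    refine ⟨A j + S, ?_, ?_⟩
    · rw [Finset.sum_insert hj, ← hS]
      rfl
    · rw [Finset.sum_insert hj, ← hiS, hi.map_add]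

omit [MetricSpace T] in
theorem IsRadstromEmbedding.exists_taggedPartition_sum (hi : IsRadstromEmbedding i) {E : Set T}
    (P : TaggedPartition μ E) (F : T → Cwk X) :
    ∃ S : Cwk X, (S : Set X) = P.sum (fun t => (F t : Set X)) ∧
      i S = P.vsum fun t => i (F t) := by
  obtain ⟨S, hS, hiS⟩ := hi.exists_sum Finset.univ fun j => μ.real (P.part j) • F (P.tag j)
  refine ⟨S, hS, hiS.trans (Finset.sum_congr rfl fun j _ => ?_)⟩
  exact hi.map_smul _ _ measureReal_nonneg

/-- If `i ∘ M` is the indefinite integral of `i ∘ F`, then `M E` is the norm integral of `F`. -/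
theorem IsRadstromEmbedding.normIntegral_eq [CompactSpace T] [OpensMeasurableSpace T]
    (hi : IsRadstromEmbedding i) {F : T → Cwk X} {ν : Set T → C(Ω, ℝ)}
    (hν : HasIndefiniteIntegral μ (fun t => i (F t)) ν) {E : Set T} (hE : MeasurableSet E)
    {A : Cwk X} (hA : i A = ν E) :
    (A : Set X) = normIntegral μ (fun t => (F t : Set X)) E := by
  have key : ∀ ε > 0, ∃ γ : T → ℝ, IsGauge γ ∧ ∀ P : TaggedPartition μ E, P.IsFine γ →
      ∃ S : Cwk X, (S : Set X) = P.sum (fun t => (F t : Set X)) ∧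
        hausdorffDist (S : Set X) A ≤ ε := fun ε hε => by
    obtain ⟨γ, hγ, h⟩ := hν ε hε
    refine ⟨γ, hγ, fun P hP => ?_⟩
    obtain ⟨S, hS, hiS⟩ := hi.exists_taggedPartition_sum P F
    refine ⟨S, hS, ?_⟩
    rw [hi.isometry, hiS, hA]
    exact h E hE P hP
  ext z
  constructor
  · intro hz ε hε
    obtain ⟨γ, hγ, h⟩ := key ε hε
    refine ⟨γ, hγ, fun P hP => ?_⟩
    obtain ⟨S, hS, hd⟩ := h P hP
    rw [← hS]
    rw [hausdorffDist_comm] at hd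
    exact (infDist_le_hausdorffDist_of_mem hz (A.2.hausdorffEDist_ne_top S.2)).trans hd
  · intro hz
    rw [A.2.isClosed.mem_iff_infDist_zero A.2.nonempty]
    refine le_antisymm (le_of_forall_pos_le_add fun ε hε => ?_) infDist_nonneg
    obtain ⟨γ, hγ, h⟩ := key (ε / 2) (half_pos hε)
    obtain ⟨γ', hγ', h'⟩ := hz (ε / 2) (half_pos hε)
    -- A single sum is then close both to `z` and to `A`.
    obtain ⟨P, hP⟩ := exists_isFine (μ := μ) (hγ.min hγ') hE
    obtain ⟨S, hS, hd⟩ := h P (hP.mono fun t => min_le_left _ _)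
    have h1 := h' P (hP.mono fun t => min_le_right _ _)
    rw [← hS] at h1
    linarith [infDist_le_infDist_add_hausdorffDist (x := z) (S.2.hausdorffEDist_ne_top A.2)]

end MultifunctionIntegral

/-! ### Countable additivity, in `C(Ω)` and for sets. -/

section Multimeasure

variable {T : Type*} [MeasurableSpace T] {μ : Measure T}
variable {X : Type*} [NormedAddCommGroup X] [NormedSpace ℝ X]
variable {Y : Type*} [NormedAddCommGroup Y]

/-- Finite additivity of a set function. -/
def IsFinitelyAdditive {G : Type*} [Add G] (ν : MSet T → G) : Prop :=
  ∀ E₁ E₂ : MSet T, Disjoint (E₁ : Set T) E₂ → ν ⟨E₁ ∪ E₂, E₁.2.union E₂.2⟩ = ν E₁ + ν E₂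

/-- The union of the terms of a sequence of measurable sets from the `n`-th one on. -/
def MSet.tail (E : ℕ → MSet T) (n : ℕ) : MSet T :=
  ⟨⋃ m ≥ n, (E m : Set T), MeasurableSet.biUnion (to_countable _) fun m _ => (E m).2⟩

theorem MSet.tail_zero (E : ℕ → MSet T) : MSet.tail E 0 = MSet.iUnion E :=
  Subtype.ext (by simp [MSet.tail, MSet.iUnion])

theorem MSet.tail_succ (E : ℕ → MSet T) (n : ℕ) :
    MSet.tail E n = ⟨E n ∪ MSet.tail E (n + 1), (E n).2.union (MSet.tail E (n + 1)).2⟩ := by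
  refine Subtype.ext ?_
  ext x
  simp only [MSet.tail, mem_iUnion, mem_union, exists_prop]
  constructor
  · rintro ⟨m, hm, hx⟩
    rcases hm.eq_or_lt with rfl | h
    · exact Or.inl hx
    · exact Or.inr ⟨m, h, hx⟩
  · rintro (hx | ⟨m, hm, hx⟩)
    · exact ⟨n, le_rfl, hx⟩
    · exact ⟨m, (Nat.le_succ n).trans hm, hx⟩

theorem MSet.disjoint_tail_succ {E : ℕ → MSet T}
    (hE : Pairwise fun m n => Disjoint (E m : Set T) (E n)) (n : ℕ) :
    Disjoint (E n : Set T) (MSet.tail E (n + 1)) :=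
  disjoint_iUnion₂_right.2 fun _ hm => hE (Nat.lt_of_succ_le hm).ne

theorem IsFinitelyAdditive.empty {ν : MSet T → Y} (hν : IsFinitelyAdditive ν) :
    ν ⟨∅, MeasurableSet.empty⟩ = 0 := by
  have h := hν ⟨∅, MeasurableSet.empty⟩ ⟨∅, MeasurableSet.empty⟩ (by simp)
  simp only [union_self] at h
  exact left_eq_add.1 h

theorem IsFinitelyAdditive.biUnion_finset {ν : MSet T → Y} (hν : IsFinitelyAdditive ν)
    {E : ℕ → MSet T} (hE : Pairwise fun m n => Disjoint (E m : Set T) (E n)) (s : Finset ℕ) :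
    ν ⟨⋃ n ∈ s, (E n : Set T), s.measurableSet_biUnion fun n _ => (E n).2⟩ =
      ∑ n ∈ s, ν (E n) := by
  induction s using Finset.induction_on with
  | empty => simpa using hν.empty
  | insert n s hn ih =>
    rw [Finset.sum_insert hn, ← ih, ← hν]
    · congr 2
      simp
    · refine disjoint_iUnion₂_right.2 fun m hm => hE ?_
      rintro rfl
      exact hn hm

/-- A finitely additive, absolutely continuous set function is σ-additive. -/
theorem AbsContinuous.sigmaAdditive [IsFiniteMeasure μ] {ν : MSet T → Y}
    (hν : AbsContinuous μ ν) (hadd : IsFinitelyAdditive ν) : SigmaAdditive ν := by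
  intro E hE
  have htail : Tendsto (fun n => μ.real (MSet.tail E n : Set T)) atTop (𝓝 0) :=
    (ENNReal.tendsto_toReal ENNReal.zero_ne_top).comp
      (tendsto_measure_biUnion_Ici_zero_of_pairwise_disjoint (μ := μ)
        (fun n => (E n).2.nullMeasurableSet) hE)
  refine Metric.tendsto_atTop.2 fun ε hε => ?_
  obtain ⟨δ, hδ, h⟩ := hν ε hε
  obtain ⟨N, hN⟩ := (htail.eventually (gt_mem_nhds hδ)).exists
  -- For any finite `s` containing `range N`, what remains lies in the tail from `N`, whose measure
  -- is below `δ`.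
  refine ⟨Finset.range N, fun s hs => ?_⟩
  let U : MSet T := ⟨⋃ n ∈ s, (E n : Set T), s.measurableSet_biUnion fun n _ => (E n).2⟩
  have hU : ν U = ∑ n ∈ s, ν (E n) := hadd.biUnion_finset hE s
  have hUE : (U : Set T) ⊆ MSet.iUnion E :=
    iUnion₂_subset fun n _ => subset_iUnion_of_subset n subset_rfl
  let V : MSet T := ⟨MSet.iUnion E \ U, (MSet.iUnion E).2.diff U.2⟩
  have hUV : ν (MSet.iUnion E) = ν U + ν V := by
    rw [← hadd U V disjoint_sdiff_right]
    exact congrArg ν (Subtype.ext (union_sdiff_cancel hUE).symm)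
  have hV : (V : Set T) ⊆ MSet.tail E N := by
    rintro x ⟨hx, hxU⟩
    obtain ⟨n, hn⟩ := mem_iUnion.1 hx
    refine mem_iUnion₂.2 ⟨n, ?_, hn⟩
    by_contra hnN
    exact hxU (mem_iUnion₂.2 ⟨n, hs (Finset.mem_range.2 (not_le.1 hnN)), hn⟩)
  rw [← hU, dist_comm, dist_eq_norm, hUV, add_sub_cancel_left]
  exact h V ((measureReal_mono hV).trans_lt hN)

variable {Ω : Type*} [TopologicalSpace Ω] [CompactSpace Ω] {i : Cwk X → C(Ω, ℝ)}
variable {Ω' : Type*} [TopologicalSpace Ω'] [CompactSpace Ω'] {i' : Cwk X → C(Ω', ℝ)}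

/-- `‖i A‖` is the Hausdorff distance from `A` to `{0}`, whatever the embedding. -/
theorem IsRadstromEmbedding.absContinuous_congr (hi : IsRadstromEmbedding i)
    (hi' : IsRadstromEmbedding i') {M : MSet T → Cwk X} (h : AbsContinuous μ fun E => i (M E)) :
    AbsContinuous μ fun E => i' (M E) := by
  simpa only [AbsContinuous, hi.norm_eq, hi'.norm_eq] using h

theorem IsRadstromEmbedding.isFinitelyAdditive_comp (hi : IsRadstromEmbedding i)
    {M : MSet T → Cwk X} (hM : IsFinitelyAdditive M) : IsFinitelyAdditive fun E => i (M E) :=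
  fun E₁ E₂ h => (congrArg i (hM E₁ E₂ h)).trans (hi.map_add _ _)

theorem IsRadstromEmbedding.norm_le (hi : IsRadstromEmbedding i) (A : Cwk X) {a : X}
    (ha : a ∈ (A : Set X)) : ‖a‖ ≤ ‖i A‖ := by
  rw [hi.norm_eq]
  have := infDist_le_hausdorffDist_of_mem ha (A.2.hausdorffEDist_ne_top (IsCwk.singleton 0))
  rwa [infDist_singleton, dist_zero_right] at this

/-- The sum of the points belongs to the Minkowski sum of the sets. Hence the Cauchy criterion for
the embedded series passes to every selection. -/
theorem IsRadstromEmbedding.norm_sum_le (hi : IsRadstromEmbedding i) {ι : Type*} (s : Finset ι)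
    (A : ι → Cwk X) {b : ι → X} (hb : ∀ n, b n ∈ (A n : Set X)) :
    ‖∑ n ∈ s, b n‖ ≤ ‖∑ n ∈ s, i (A n)‖ := by
  obtain ⟨S, hS, hiS⟩ := hi.exists_sum s A
  rw [← hiS]
  exact hi.norm_le S (hS ▸ Set.finsetSum_mem_finsetSum s _ _ fun n _ => hb n)

/-- A finitely additive set function with values in `cwk(X)` is a countably additive multimeasure
if it is σ-additive after a Rådström embedding. -/
theorem IsRadstromEmbedding.isCountablyAdditiveMultimeasure [CompleteSpace X]
    (hi : IsRadstromEmbedding i) {M : MSet T → Cwk X} (hM : IsFinitelyAdditive M)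
    (hσ : SigmaAdditive fun E => i (M E)) : IsCountablyAdditiveMultimeasure M := by
  have hunc : ∀ E : ℕ → MSet T, (Pairwise fun m n => Disjoint (E m : Set T) (E n)) →
      UncondConvergent fun n => (M (E n) : Set X) := fun E hE b hb => by
    refine summable_iff_vanishing_norm.2 fun ε hε => ?_
    obtain ⟨s, hs⟩ := summable_iff_vanishing_norm.1 (hσ E hE).summable ε hε
    exact ⟨s, fun t ht => (hi.norm_sum_le t _ hb).trans_lt (hs t ht)⟩
  refine ⟨?_, hunc, fun E hE => Subset.antisymm ?_ ?_⟩
  · have h := (hi.isFinitelyAdditive_comp hM).empty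
    exact congrArg Subtype.val (hi.injective (h.trans hi.map_zero.symm))
  · intro x hx
    -- Finite additivity splits a point of `M (tail E n)` into a term in `M (E n)` and a remainder
    -- in the next tail; iterating from `x` produces the series.
    have hstep : ∀ (n : ℕ) (r : (M (MSet.tail E n) : Set X)),
        ∃ a ∈ (M (E n) : Set X), ∃ r' : (M (MSet.tail E (n + 1)) : Set X), a + r' = (r : X) := by
      intro n r
      have hr : (r : X) ∈ ((M (E n) + M (MSet.tail E (n + 1)) : Cwk X) : Set X) := by
        rw [← hM _ _ (MSet.disjoint_tail_succ hE n), ← MSet.tail_succ]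
        exact r.2
      obtain ⟨a, ha, r', hr', h⟩ := hr
      exact ⟨a, ha, ⟨r', hr'⟩, h⟩
    choose a ha next hnext using hstep
    obtain ⟨r, hrx, hrn⟩ : ∃ r : ∀ n, (M (MSet.tail E n) : Set X),
        (r 0 : X) = x ∧ ∀ n, r (n + 1) = next n (r n) :=
      ⟨fun n => Nat.rec (motive := fun n => (M (MSet.tail E n) : Set X))
        ⟨x, by rw [MSet.tail_zero]; exact hx⟩ next n, rfl, fun _ => rfl⟩
    have hr : ∀ n, a n (r n) + (r (n + 1) : X) = r n := fun n => by rw [hrn, hnext]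
    have hsum : ∀ n, ∑ m ∈ Finset.range n, a m (r m) = x - r n := fun n => by
      induction n with
      | zero => simp [hrx]
      | succ n ih => rw [Finset.sum_range_succ, ih, ← hr n]; abel
    have htail : ∀ n, i (M (MSet.tail E n)) =
        i (M (MSet.iUnion E)) - ∑ m ∈ Finset.range n, i (M (E m)) := fun n => by
      induction n with
      | zero => simp [MSet.tail_zero]
      | succ n ih =>
        rw [MSet.tail_succ, hM _ _ (MSet.disjoint_tail_succ hE n), hi.map_add] at ih
        rw [Finset.sum_range_succ, ← sub_sub, ← ih, add_sub_cancel_left]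
    -- The remainder is dominated by `‖i (M (tail E n))‖`, the norm of the tail of a convergent
    -- series.
    have hr0 : Tendsto (fun n => (r n : X)) atTop (𝓝 0) := by
      refine squeeze_zero_norm (fun n => hi.norm_le _ (r n).2) ?_
      simp only [htail]
      simpa using ((hσ E hE).tendsto_sum_nat.const_sub (i (M (MSet.iUnion E)))).norm
    have hb : ∀ n, a n (r n) ∈ (M (E n) : Set X) := fun n => ha n (r n)
    refine ⟨fun n => a n (r n), hb, ?_⟩
    rw [(hunc E hE _ hb).hasSum_iff_tendsto_nat]
    simp only [hsum]
    simpa using hr0.const_sub x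
  · rintro x ⟨b, hb, hbx⟩
    rw [(M _).2.isClosed.mem_iff_infDist_zero (M _).2.nonempty]
    -- The distance from a partial sum to the closed set `M (iUnion E)` is at most the error of the
    -- embedded series.
    have h1 : Tendsto (fun s : Finset ℕ => infDist (∑ n ∈ s, b n) (M (MSet.iUnion E) : Set X))
        atTop (𝓝 (infDist x (M (MSet.iUnion E) : Set X))) :=
      ((continuous_infDist_pt _).tendsto x).comp hbx
    refine tendsto_nhds_unique h1 (squeeze_zero (fun _ => infDist_nonneg) (fun s => ?_)
      (tendsto_iff_norm_sub_tendsto_zero.1 (hσ E hE)))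
    obtain ⟨S, hS, hiS⟩ := hi.exists_sum s fun n => M (E n)
    rw [← hiS, ← hi.isometry]
    exact infDist_le_hausdorffDist_of_mem
      (hS ▸ Set.finsetSum_mem_finsetSum s _ _ fun n _ => hb n) (S.2.hausdorffEDist_ne_top (M _).2)

end Multimeasure

/-- The norm integral of an H-integrable multifunction is an additive, absolutely continuous
`cwk(X)`-valued set function. -/
theorem HIntegrable.exists_normIntegral {T : Type*} [MetricSpace T] [CompactSpace T]
    [MeasurableSpace T] [BorelSpace T] {μ : Measure T} [IsFiniteMeasure μ]
    {X : Type*} [NormedAddCommGroup X] [NormedSpace ℝ X]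
    {F : T → Cwk X} (hF : HIntegrable μ F) {Ω : Type*} [TopologicalSpace Ω] [CompactSpace Ω]
    {i : Cwk X → C(Ω, ℝ)} (hi : IsRadstromEmbedding i) :
    ∃ M : MSet T → Cwk X,
      (∀ E : MSet T, (M E : Set X) = normIntegral μ (fun t => (F t : Set X)) (E : Set T)) ∧
      IsFinitelyAdditive M ∧ AbsContinuous μ fun E => i (M E) := by
  obtain ⟨J, hJ⟩ := hF
  obtain ⟨ν, hν⟩ := exists_hasIndefiniteIntegral (μ := μ) (f := fun t => i (F t)) (y := i J)
    fun ε hε => by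
      obtain ⟨γ, hγ, h⟩ := hJ ε hε
      refine ⟨γ, hγ, fun P hP => ?_⟩
      obtain ⟨S, hS, hiS⟩ := hi.exists_taggedPartition_sum P F
      rw [← hiS, ← hi.isometry, hS]
      exact h P hP
  have hrange : ∀ E : MSet T, ∃ A : Cwk X, i A = ν E := fun E =>
    hν.mem_of_isClosed hi.isClosed_range E.2 fun P => by
      obtain ⟨S, -, hiS⟩ := hi.exists_taggedPartition_sum P F
      exact ⟨S, hiS⟩
  choose M hM using hrange
  refine ⟨M, fun E => hi.normIntegral_eq hν E.2 (hM E), fun E₁ E₂ h => hi.injective ?_, ?_⟩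
  · rw [hi.map_add, hM, hM, hM]
    exact hν.union E₁.2 E₂.2 h
  · intro ε hε
    obtain ⟨δ, hδ, h⟩ := hν.absContinuous ε hε
    refine ⟨δ, hδ, fun E hE => ?_⟩
    change ‖i (M E)‖ < ε
    rw [hM]
    exact h E E.2 hE

end HMultifun

theorem corollary3p10
    {T : Type v} [MetricSpace T] [CompactSpace T] [MeasurableSpace T] [BorelSpace T]
    (μ : Measure T) [IsFiniteMeasure μ] [NullSingletonClass μ]
    {X : Type u} [NormedAddCommGroup X] [NormedSpace ℝ X] [CompleteSpace X]
    (F : T → HMultifun.Cwk X) (hF : HMultifun.HIntegrable μ F) :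
    -- Rådström embeddings of `cwk(X)` exist
    (∃ (Ω : Type u) (_ : TopologicalSpace Ω) (_ : CompactSpace Ω) (_ : T2Space Ω)
      (i : HMultifun.Cwk X → C(Ω, ℝ)), HMultifun.IsRadstromEmbedding i) ∧
    -- `E ↦ Φ(F, E)` is a `cwk(X)`-valued set function `M` with the stated properties
    ∃ M : HMultifun.MSet T → HMultifun.Cwk X,
      (∀ E : HMultifun.MSet T,
        (M E : Set X) = HMultifun.normIntegral μ (fun t => (F t : Set X)) (E : Set T)) ∧
      HMultifun.IsCountablyAdditiveMultimeasure M ∧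
      ∀ {Ω : Type w} [TopologicalSpace Ω] [CompactSpace Ω] [T2Space Ω]
        (i : HMultifun.Cwk X → C(Ω, ℝ)), HMultifun.IsRadstromEmbedding i →
        HMultifun.SigmaAdditive (fun E => i (M E)) ∧
        HMultifun.AbsContinuous μ (fun E => i (M E)) := by
  obtain ⟨Ω₀, _, _, _, i₀, hi₀⟩ := HMultifun.exists_isRadstromEmbedding (X := X)
  obtain ⟨M, hM, hadd, hac⟩ := hF.exists_normIntegral hi₀
  refine ⟨⟨Ω₀, _, _, ‹_›, i₀, hi₀⟩, M, hM, hi₀.isCountablyAdditiveMultimeasure hadd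
    (hac.sigmaAdditive (hi₀.isFinitelyAdditive_comp hadd)), fun i hi => ?_⟩
  -- `M` was built from `i₀`; absolute continuity transfers to any `i`, and σ-additivity is deduced
  -- from it anew.
  have hac' := hi₀.absContinuous_congr hi hac
  exact ⟨hac'.sigmaAdditive (hi.isFinitelyAdditive_comp hadd), hac'⟩
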